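/- Let $\mathcal{X}=\{1,2,\dots\}$. For each $n\ge 1$ let $(X_n,Y_n)$ be a pair of random variables defined on some probability space (which may depend on $n$), where $X_n$ takes values in $\mathcal{X}$ and $Y_n$ takes values in a nonempty measurable space $\mathcal{Y}_n$ (for instance a standard Borel space), and let $L_n\ge 1$ be an integer. Write $P_{X_n}$ for the distribution of $X_n$ and $P_{X_n|Y_n}$ for the regular conditional distribution of $X_n$ given $Y_n$. For a probability distribution $P$ on $\mathcal{X}$ let $H(P)=\sum_{x\in\mathcal{X}}P(x)\log\frac{1}{P(x)}\in[0,\infty]$ (with $0\log\frac10=0$), and put $H(X_n)=H(P_{X_n})$ and $H(X_n\mid Y_n)=\mathbb{E}[H(P_{X_n|Y_n})]$. Let $$P_{\mathrm e}^{(L)}(X\mid Y)=\min_{f}\mathbb{P}\{X\notin f(Y)\},$$ where $f$ ranges over all measurable maps from the range space of $Y$ to the set of nonempty subsets of $\mathcal{X}$ with at most $L$ elements. Write $|u|^+=\max\{0,u\}$. Suppose that $\{X_n\}_{n\ge1}$ satisfies the asymptotic equipartition property $$\lim_{n\to\infty}\mathbb{P}\Big\{\log\frac{1}{P_{X_n}(X_n)}\le(1-\delta)\,H(X_n)\Big\}=0\qquad\text{for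 every fixed }\delta>0,$$ and that $H(X_n)=\Omega(1)$, i.e. there is a constant $c>0$ with $H(X_n)\ge c$ for all sufficiently large $n$. Then $$P_{\mathrm e}^{(L_n)}(X_n\mid Y_n)=\mathrm{o}(1)\ \Longrightarrow\ \big|H(X_n\mid Y_n)-\log L_n\big|^+=\mathrm{o}\big(H(X_n)\big).$$ Consequently, $$P_{\mathrm e}^{(L_n)}(X_n\mid Y_n)=\mathrm{o}(1)\ \text{ and }\ \log L_n=\mathrm{o}\big(H(X_n)\big)\ \Longrightarrow\ H(X_n\mid Y_n)=\mathrm{o}\big(H(X_n)\big).$$ -/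

import Mathlib

open MeasureTheory ProbabilityTheory Filter Topology
open scoped ENNReal NNReal

noncomputable section

namespace ListFano

/-- The alphabet `{1, 2, …}` carries the discrete σ-algebra. -/
instance instMeasurableSpacePNat : MeasurableSpace ℕ+ := ⊤

instance instDiscreteMeasurableSpacePNat : DiscreteMeasurableSpace ℕ+ := ⟨fun _ => trivial⟩

/-- The Shannon entropy `H(p) = ∑ₓ p(x) log (1 / p(x)) ∈ [0, ∞]` of a distribution `p` on the
countably infinite alphabet `{1, 2, …}` (natural logarithm, `0 log (1 / 0) = 0`).
Here `Real.negMulLog t = - t * log t`, which is nonnegative on `[0, 1]`. -/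
def entropy (p : Measure ℕ+) : ℝ≥0∞ :=
  ∑' x : ℕ+, ENNReal.ofReal (Real.negMulLog (p.real {x}))

section RandomVariables

variable {Ω : Type*} [MeasurableSpace Ω] {𝒴 : Type*} [MeasurableSpace 𝒴]

/-- The Shannon entropy `H(X) ∈ [0, ∞]` of a random variable `X` on `(Ω, P)`: the entropy of its
law. -/
def rvEntropy (P : Measure Ω) (X : Ω → ℕ+) : ℝ≥0∞ :=
  entropy (P.map X)

/-- The conditional Shannon entropy (equivocation) `H(X | Y) = 𝔼[H(P_{X|Y})] ∈ [0, ∞]`, where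
`P_{X|Y}` is the regular conditional distribution of `X` given `Y`. -/
def condEntropy (P : Measure Ω) [IsFiniteMeasure P] (X : Ω → ℕ+) (Y : Ω → 𝒴) : ℝ≥0∞ :=
  ∫⁻ ω, entropy (condDistrib X Y P (Y ω)) ∂P

/-- A list decoder with list size `L`: it sends each `y` to a nonempty set of at most `L`
candidates. The second clause is measurability of `f` for the discrete σ-algebra on the
(countable) set of finite subsets of `{1, 2, …}`; it makes `{X ∉ f(Y)}` an event. -/
def IsListDecoder (L : ℕ) (f : 𝒴 → Finset ℕ+) : Prop :=
  (∀ y, (f y).Nonempty ∧ (f y).card ≤ L) ∧ ∀ x : ℕ+, MeasurableSet {y | x ∈ f y}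

/-- The minimum average probability of list decoding error
`P_e^{(L)}(X | Y) = min_f ℙ{X ∉ f(Y)}`, over all list decoders `f` with list size `L`. -/
def listError (P : Measure Ω) (L : ℕ) (X : Ω → ℕ+) (Y : Ω → 𝒴) : ℝ≥0∞ :=
  ⨅ (f : 𝒴 → Finset ℕ+) (_ : IsListDecoder L f), P {ω | X ω ∉ f (Y ω)}

end RandomVariables

/-- The asymptotic equipartition property of a general source `(X n)`: for every `δ > 0`,
`ℙ{log (1 / P_{X n}(X n)) ≤ (1 - δ) H(X n)} → 0`. Both sides of the inequality are extended
reals, so that no finiteness of the entropy is presupposed. -/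
def SatisfiesAEP {Ω : ℕ → Type*} [∀ n, MeasurableSpace (Ω n)]
    (P : ∀ n, Measure (Ω n)) (X : ∀ n, Ω n → ℕ+) : Prop :=
  ∀ δ : ℝ, 0 < δ →
    Tendsto
      (fun n => P n {ω | ENNReal.log (1 / (P n).map (X n) {X n ω}) ≤
        ((1 - δ : ℝ) : EReal) * (rvEntropy (P n) (X n) : EReal)})
      atTop (𝓝 0)

/-- `a n = o(b n)` for sequences in `[0, ∞]`: for every real `c > 0`, eventually
`a n ≤ c * b n`. -/
def IsLittleOh (a b : ℕ → ℝ≥0∞) : Prop :=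
  ∀ c : ℝ≥0, 0 < c → ∀ᶠ n in atTop, a n ≤ c * b n

/-- `b n = Ω(1)` for a sequence in `[0, ∞]`: it is eventually bounded below by a constant
`c > 0`. -/
def IsOmegaOne (b : ℕ → ℝ≥0∞) : Prop :=
  ∃ c : ℝ≥0, 0 < c ∧ ∀ᶠ n in atTop, (c : ℝ≥0∞) ≤ b n

end ListFano

end

namespace ListFano

/-! Given `Y = y`, describe `X` by a code: a symbol on the decoder's list costs `log L + log (1 / (1
- η))`, any other `log (1 / η)` plus its surprisal under the unconditional law of `X`. By Gibbs'
inequality the mean length bounds `H(X | Y)`, so with error event `E` the excess over `log L` is at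
most `log (1 / (1 - η)) + P(E) log (1 / η) + 𝔼[surprisal; E]` (`condEntropy_le`). The AEP controls
the last term: outside `E` the surprisal already accounts for nearly all of its mean `H(X)`, leaving
`o(H(X))` for `E` (`setLIntegral_surprisal_le`). The other terms are small against `H(X)`, which is
bounded below. -/

open scoped Classical in
/-- The information content `log (1 / p(x)) ∈ [0, ∞]` of a symbol. -/
noncomputable def surprisal (p : Measure ℕ+) (x : ℕ+) : ℝ≥0∞ :=
  if p {x} = 0 then ⊤ else ENNReal.ofReal (-Real.log (p.real {x}))

/-! ### Entropy as mean surprisal, and Gibbs' inequality. -/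

theorem tsum_measure_singleton_mul (p : Measure ℕ+) (c : ℕ+ → ℝ≥0∞) :
    ∑' x, p {x} * c x = ∫⁻ x, c x ∂p := by
  rw [lintegral_countable']
  exact tsum_congr fun x => mul_comm _ _

theorem entropy_eq_lintegral_surprisal (p : Measure ℕ+) [IsProbabilityMeasure p] :
    entropy p = ∫⁻ x, surprisal p x ∂p := by
  rw [← tsum_measure_singleton_mul, entropy]
  refine tsum_congr fun x => ?_
  by_cases h : p {x} = 0
  · simp [h, Measure.real]
  · rw [surprisal, if_neg h, Real.negMulLog, neg_mul_comm,
      ENNReal.ofReal_mul measureReal_nonneg, ofReal_measureReal]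

/-- One term of Gibbs' inequality: `1 + u ≤ exp u` at `u = -c - log q`, multiplied by `q`. Keeping
`q` on the left avoids truncated subtraction. -/
theorem ofReal_negMulLog_add_le {q c r : ℝ≥0∞} (hq : q ≤ 1)
    (hr : c ≠ ⊤ → ENNReal.ofReal (Real.exp (-c.toReal)) ≤ r) :
    ENNReal.ofReal (Real.negMulLog q.toReal) + q ≤ q * c + r := by
  rcases eq_or_ne q 0 with rfl | h0
  · simp
  rcases eq_or_ne c ⊤ with rfl | hc
  · simp [ENNReal.mul_top h0]
  have hqt : q ≠ ⊤ := ne_top_of_le_ne_top ENNReal.one_ne_top hq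
  have hpos : 0 < q.toReal := ENNReal.toReal_pos h0 hqt
  have hle : q.toReal ≤ 1 := by
    simpa using ENNReal.toReal_mono ENNReal.one_ne_top hq
  refine le_trans ?_ (add_le_add le_rfl (hr hc))
  lift q to ℝ≥0 using hqt
  lift c to ℝ≥0 using hc
  simp only [ENNReal.coe_toReal] at *
  have key : Real.negMulLog (q : ℝ) + q ≤ q * c + Real.exp (-(c : ℝ)) := by
    have h1 := Real.add_one_le_exp (-(c : ℝ) - Real.log q)
    have h2 : (q : ℝ) * Real.exp (-(c : ℝ) - Real.log q) = Real.exp (-(c : ℝ)) := by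
      rw [Real.exp_sub, Real.exp_log hpos]
      field_simp
    have h3 := mul_le_mul_of_nonneg_left h1 hpos.le
    rw [h2] at h3
    rw [Real.negMulLog]
    nlinarith
  calc ENNReal.ofReal (Real.negMulLog q) + q
      = ENNReal.ofReal (Real.negMulLog q + q) := by
        rw [ENNReal.ofReal_add (Real.negMulLog_nonneg hpos.le hle) hpos.le,
          ENNReal.ofReal_coe_nnreal]
    _ ≤ ENNReal.ofReal (q * c + Real.exp (-(c : ℝ))) := ENNReal.ofReal_le_ofReal key
    _ = _ := by
        rw [ENNReal.ofReal_add (by positivity) (Real.exp_pos _).le,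
          ENNReal.ofReal_mul hpos.le, ENNReal.ofReal_coe_nnreal, ENNReal.ofReal_coe_nnreal]

/-- Gibbs' inequality: the entropy is at most the mean of any code length function `c` that
satisfies Kraft's inequality. -/
theorem entropy_le_lintegral_of_kraft (q : Measure ℕ+) [IsProbabilityMeasure q]
    {c r : ℕ+ → ℝ≥0∞} (hr : ∀ x, c x ≠ ⊤ → ENNReal.ofReal (Real.exp (-(c x).toReal)) ≤ r x)
    (hsum : ∑' x, r x ≤ 1) :
    entropy q ≤ ∫⁻ x, c x ∂q := by
  have hone : ∑' x, q {x} = 1 := by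
    simpa using tsum_measure_singleton_mul q 1
  have h : ∑' x, (ENNReal.ofReal (Real.negMulLog (q.real {x})) + q {x})
      ≤ ∑' x, (q {x} * c x + r x) :=
    ENNReal.tsum_le_tsum fun x => ofReal_negMulLog_add_le prob_le_one (hr x)
  rw [ENNReal.tsum_add, ENNReal.tsum_add, hone, tsum_measure_singleton_mul] at h
  exact (ENNReal.add_le_add_iff_right ENNReal.one_ne_top).1 (h.trans (add_le_add le_rfl hsum))

/-! ### The list code. -/

open scoped Classical in
/-- The code length of `x` in a code built from a list `s` and the distribution `p`: symbols on
the list are described by their position, and the others by an optimal code for `p`. -/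
noncomputable def listCost (p : Measure ℕ+) (L : ℕ) (η : ℝ) (s : Finset ℕ+) (x : ℕ+) : ℝ≥0∞ :=
  if x ∈ s then ENNReal.ofReal (Real.log L) + ENNReal.ofReal (-Real.log (1 - η))
  else ENNReal.ofReal (-Real.log η) + surprisal p x

theorem entropy_le_lintegral_listCost (p q : Measure ℕ+) [IsProbabilityMeasure p]
    [IsProbabilityMeasure q] {L : ℕ} (hL : 1 ≤ L) {η : ℝ} (h0 : 0 < η) (h1 : η < 1)
    {s : Finset ℕ+} (hs : s.card ≤ L) :
    entropy q ≤ ∫⁻ x, listCost p L η s x ∂q := by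
  classical
  have hL0 : (0 : ℝ) < L := by exact_mod_cast hL
  have hlogL : 0 ≤ Real.log L := Real.log_natCast_nonneg L
  have hη : 0 ≤ -Real.log η := neg_nonneg.2 (Real.log_nonpos h0.le h1.le)
  have hη' : 0 ≤ -Real.log (1 - η) :=
    neg_nonneg.2 (Real.log_nonpos (by linarith) (by linarith))
  -- Kraft weights: mass `1 - η` spread over `L` list positions, plus `η` times `p`. On the list the
  -- second summand is only slack.
  refine entropy_le_lintegral_of_kraft q
    (r := fun x => (if x ∈ s then ENNReal.ofReal ((1 - η) / L) else 0)
      + ENNReal.ofReal η * p {x}) (fun x hx => ?_) ?_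
  · by_cases hxs : x ∈ s
    · simp only [listCost, if_pos hxs]
      refine le_trans (le_of_eq ?_) le_self_add
      rw [ENNReal.toReal_add ENNReal.ofReal_ne_top ENNReal.ofReal_ne_top,
        ENNReal.toReal_ofReal hlogL, ENNReal.toReal_ofReal hη', neg_add, neg_neg, Real.exp_add,
        Real.exp_neg, Real.exp_log hL0, Real.exp_log (by linarith), div_eq_inv_mul]
    · simp only [listCost, if_neg hxs] at hx ⊢
      have hp : p {x} ≠ 0 := fun h => hx (by simp [surprisal, h])
      have hpos : 0 < p.real {x} := ENNReal.toReal_pos hp (measure_ne_top _ _)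
      rw [surprisal, if_neg hp, ENNReal.toReal_add ENNReal.ofReal_ne_top ENNReal.ofReal_ne_top,
        ENNReal.toReal_ofReal hη, ENNReal.toReal_ofReal
          (neg_nonneg.2 (Real.log_nonpos hpos.le measureReal_le_one)), neg_add, neg_neg, neg_neg,
        Real.exp_add, Real.exp_log h0, Real.exp_log hpos, ENNReal.ofReal_mul h0.le,
        ofReal_measureReal, zero_add]
  · have hone : ∑' x, p {x} = 1 := by
      simpa using tsum_measure_singleton_mul p 1
    rw [ENNReal.tsum_add, ENNReal.tsum_mul_left, hone, mul_one,
      tsum_eq_sum (s := s) (fun x hx => if_neg hx), Finset.sum_congr rfl (fun x hx => if_pos hx),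
      Finset.sum_const, nsmul_eq_mul, ← ENNReal.ofReal_natCast,
      ← ENNReal.ofReal_mul (Nat.cast_nonneg _),
      ← ENNReal.ofReal_add (mul_nonneg (Nat.cast_nonneg _)
        (div_nonneg (by linarith) hL0.le)) h0.le, ← ENNReal.ofReal_one]
    refine ENNReal.ofReal_le_ofReal ?_
    have : (s.card : ℝ) * ((1 - η) / L) ≤ L * ((1 - η) / L) :=
      mul_le_mul_of_nonneg_right (by exact_mod_cast hs) (div_nonneg (by linarith) hL0.le)
    rw [mul_div_cancel₀ _ hL0.ne'] at this
    linarith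

/-! ### Bounds for a single pair of random variables. -/

section RandomVariables

variable {Ω : Type*} [MeasurableSpace Ω] {𝒴 : Type*} [MeasurableSpace 𝒴]

theorem measurableSet_listError {L : ℕ} {f : 𝒴 → Finset ℕ+} (hf : IsListDecoder L f)
    {X : Ω → ℕ+} (hX : Measurable X) {Y : Ω → 𝒴} (hY : Measurable Y) :
    MeasurableSet {ω | X ω ∉ f (Y ω)} := by
  have h : {ω | X ω ∉ f (Y ω)} = ⋃ x : ℕ+, X ⁻¹' {x} ∩ (Y ⁻¹' {y | x ∈ f y})ᶜ := by
    ext ω; simp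
  rw [h]
  exact .iUnion fun x => (hX (measurableSet_singleton x)).inter (hY (hf.2 x)).compl

theorem condEntropy_le (P : Measure Ω) [IsProbabilityMeasure P] {X : Ω → ℕ+} (hX : Measurable X)
    {Y : Ω → 𝒴} (hY : Measurable Y) {L : ℕ} (hL : 1 ≤ L) {f : 𝒴 → Finset ℕ+}
    (hf : IsListDecoder L f) {η : ℝ} (h0 : 0 < η) (h1 : η < 1) :
    condEntropy P X Y ≤ ENNReal.ofReal (Real.log L) + ENNReal.ofReal (-Real.log (1 - η)) +
      (ENNReal.ofReal (-Real.log η) * P {ω | X ω ∉ f (Y ω)} +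
        ∫⁻ ω in {ω | X ω ∉ f (Y ω)}, surprisal (P.map X) (X ω) ∂P) := by
  classical
  have := Measure.isProbabilityMeasure_map (μ := P) hX.aemeasurable
  have := Measure.isProbabilityMeasure_map (μ := P) hY.aemeasurable
  have hE := measurableSet_listError hf hX hY
  have hc : Measurable fun z : 𝒴 × ℕ+ => listCost (P.map X) L η (f z.1) z.2 := by
    refine measurable_from_prod_countable_left fun x => ?_
    exact Measurable.ite (hf.2 x) measurable_const
      (measurable_const (a := ENNReal.ofReal (-Real.log η) + surprisal (P.map X) x))
  calc condEntropy P X Y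
      ≤ ∫⁻ ω, ∫⁻ x, listCost (P.map X) L η (f (Y ω)) x ∂condDistrib X Y P (Y ω) ∂P :=
        lintegral_mono fun ω => entropy_le_lintegral_listCost _ _ hL h0 h1 (hf.1 (Y ω)).2
    _ = ∫⁻ y, ∫⁻ x, listCost (P.map X) L η (f y) x ∂condDistrib X Y P y ∂P.map Y :=
        (lintegral_map (f := fun y => ∫⁻ x, listCost (P.map X) L η (f y) x ∂condDistrib X Y P y)
          hc.lintegral_kernel_prod_right' hY).symm
    _ = ∫⁻ z, listCost (P.map X) L η (f z.1) z.2 ∂(P.map Y ⊗ₘ condDistrib X Y P) :=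
        (Measure.lintegral_compProd hc).symm
    _ = ∫⁻ ω, listCost (P.map X) L η (f (Y ω)) (X ω) ∂P := by
        rw [compProd_map_condDistrib hX.aemeasurable, lintegral_map hc (hY.prodMk hX)]
    _ = (∫⁻ ω in {ω | X ω ∉ f (Y ω)}ᶜ, listCost (P.map X) L η (f (Y ω)) (X ω) ∂P) +
        ∫⁻ ω in {ω | X ω ∉ f (Y ω)}, listCost (P.map X) L η (f (Y ω)) (X ω) ∂P := by
        rw [add_comm, lintegral_add_compl _ hE]
    _ ≤ _ := by
        refine add_le_add ?_ (le_of_eq ?_)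
        · rw [setLIntegral_congr_fun
            (f := fun ω => listCost (P.map X) L η (f (Y ω)) (X ω))
            (g := fun _ => ENNReal.ofReal (Real.log L) +
            ENNReal.ofReal (-Real.log (1 - η))) hE.compl
            (fun ω hω => if_pos (not_not.1 hω)), setLIntegral_const]
          exact mul_le_of_le_one_right' prob_le_one
        · rw [setLIntegral_congr_fun
            (f := fun ω => listCost (P.map X) L η (f (Y ω)) (X ω))
            (g := fun ω => ENNReal.ofReal (-Real.log η) +
            surprisal (P.map X) (X ω)) hE (fun ω hω => if_neg hω),
            lintegral_add_left measurable_const, setLIntegral_const]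

theorem rvEntropy_eq_lintegral_surprisal (P : Measure Ω) [IsProbabilityMeasure P] {X : Ω → ℕ+}
    (hX : Measurable X) : rvEntropy P X = ∫⁻ ω, surprisal (P.map X) (X ω) ∂P := by
  have := Measure.isProbabilityMeasure_map (μ := P) hX.aemeasurable
  rw [rvEntropy, entropy_eq_lintegral_surprisal, lintegral_map .of_discrete hX]

theorem log_one_div_le_of_surprisal_le (p : Measure ℕ+) [IsProbabilityMeasure p] {x : ℕ+}
    {t : ℝ≥0∞} (ht : t ≠ ⊤) (h : surprisal p x ≤ t) :
    ENNReal.log (1 / p {x}) ≤ (t : EReal) := by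
  have hp : p {x} ≠ 0 := fun h0 => ht (top_le_iff.1 (by simpa [surprisal, h0] using h))
  rw [surprisal, if_neg hp] at h
  have hpos : 0 < p.real {x} := ENNReal.toReal_pos hp (measure_ne_top _ _)
  rw [one_div, ENNReal.log_inv, ENNReal.log_pos_real hp (measure_ne_top _ _), ← EReal.coe_neg]
  refine le_trans ?_ (EReal.coe_ennreal_le_coe_ennreal_iff.2 h)
  rw [EReal.coe_ennreal_ofReal]
  exact EReal.coe_le_coe_iff.2 (le_max_left _ _)

/-- Off `E` and the AEP-exceptional event `B`, the surprisal is at least `t = (1 - δ) H`, so `Eᶜ`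
carries at least `t (1 - P E - P B)` of the total `H`. Finiteness of `H` allows `t` to be cancelled.
-/
theorem setLIntegral_surprisal_le (P : Measure Ω) [IsProbabilityMeasure P] {X : Ω → ℕ+}
    (hX : Measurable X) (hH : rvEntropy P X ≠ ⊤) {δ : ℝ} (h0 : 0 < δ) (h1 : δ < 1) {E : Set Ω}
    (hE : MeasurableSet E) :
    ∫⁻ ω in E, surprisal (P.map X) (X ω) ∂P ≤ (ENNReal.ofReal δ + (P E +
      P {ω | ENNReal.log (1 / P.map X {X ω}) ≤ ((1 - δ : ℝ) : EReal) * (rvEntropy P X : EReal)}))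
      * rvEntropy P X := by
  have := Measure.isProbabilityMeasure_map (μ := P) hX.aemeasurable
  set H := rvEntropy P X with hHdef
  set B := {ω | ENNReal.log (1 / P.map X {X ω}) ≤ ((1 - δ : ℝ) : EReal) * (H : EReal)} with hB
  set t : ℝ≥0∞ := ENNReal.ofReal (1 - δ) * H with ht
  have htt : t ≠ ⊤ := ENNReal.mul_ne_top ENNReal.ofReal_ne_top hH
  have hBm : MeasurableSet B := by
    have : B = X ⁻¹' {x | ENNReal.log (1 / P.map X {x}) ≤ ((1 - δ : ℝ) : EReal) * (H : EReal)} :=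
      rfl
    rw [this]
    exact hX (.of_discrete)
  have hge : ∀ ω ∈ Eᶜ ∩ Bᶜ, t ≤ surprisal (P.map X) (X ω) := by
    intro ω hω
    by_contra! hlt
    refine hω.2 ?_
    have := log_one_div_le_of_surprisal_le (P.map X) htt hlt.le
    rw [ht, EReal.coe_ennreal_mul, EReal.coe_ennreal_ofReal, max_eq_left (by linarith)] at this
    exact this
  have hlow : t * P (Eᶜ ∩ Bᶜ) ≤ ∫⁻ ω in Eᶜ, surprisal (P.map X) (X ω) ∂P := by
    rw [← setLIntegral_const]
    exact (setLIntegral_mono' (hE.compl.inter hBm.compl) hge).trans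
      (lintegral_mono_set Set.inter_subset_left)
  have hprob : 1 ≤ P (Eᶜ ∩ Bᶜ) + (P E + P B) := by
    rw [← Set.compl_union, ← prob_add_prob_compl (μ := P) (hE.union hBm), add_comm]
    exact add_le_add le_rfl (measure_union_le _ _)
  have htH : t ≤ H := mul_le_of_le_one_left' (ENNReal.ofReal_le_one.2 (by linarith))
  have hsplit : H = ENNReal.ofReal δ * H + t := by
    rw [ht, ← add_mul, ← ENNReal.ofReal_add h0.le (by linarith)]
    simp
  refine (ENNReal.add_le_add_iff_right htt).1 ?_
  calc ∫⁻ ω in E, surprisal (P.map X) (X ω) ∂P + t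
      ≤ ∫⁻ ω in E, surprisal (P.map X) (X ω) ∂P + t * (P (Eᶜ ∩ Bᶜ) + (P E + P B)) := by
        gcongr
        exact le_mul_of_one_le_right' hprob
    _ ≤ (∫⁻ ω in E, surprisal (P.map X) (X ω) ∂P + ∫⁻ ω in Eᶜ, surprisal (P.map X) (X ω) ∂P) +
        H * (P E + P B) := by
        rw [mul_add, ← add_assoc]
        gcongr
    _ = H + H * (P E + P B) := by
        rw [lintegral_add_compl _ hE, ← rvEntropy_eq_lintegral_surprisal P hX]
    _ = (ENNReal.ofReal δ + (P E + P B)) * H + t := by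
        rw [add_mul, mul_comm (P E + P B)]
        nth_rewrite 1 [hsplit]
        ring

end RandomVariables

/-! ### Asymptotics. -/

theorem isLittleOh_condEntropy_sub_log {Ω : ℕ → Type*} {𝒴 : ℕ → Type*}
    [∀ n, MeasurableSpace (Ω n)] [∀ n, MeasurableSpace (𝒴 n)]
    (P : ∀ n, Measure (Ω n)) [∀ n, IsProbabilityMeasure (P n)]
    (X : ∀ n, Ω n → ℕ+) (hX : ∀ n, Measurable (X n))
    (Y : ∀ n, Ω n → 𝒴 n) (hY : ∀ n, Measurable (Y n))
    (L : ℕ → ℕ) (hL : ∀ n, 1 ≤ L n) (hAEP : SatisfiesAEP P X)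
    (hH : IsOmegaOne (fun n => rvEntropy (P n) (X n)))
    (herr : Tendsto (fun n => listError (P n) (L n) (X n) (Y n)) atTop (𝓝 0)) :
    IsLittleOh (fun n => condEntropy (P n) (X n) (Y n) - ENNReal.ofReal (Real.log (L n)))
      (fun n => rvEntropy (P n) (X n)) := by
  intro c hc
  obtain ⟨b, hb, hbH⟩ := hH
  have hc' : (0 : ℝ) < c := hc
  have hb' : (0 : ℝ) < b := hb
  set δ : ℝ := min (c / 4) (1 / 2)
  have hδ0 : 0 < δ := lt_min (by positivity) (by norm_num)
  have hδ1 : δ < 1 := (min_le_right _ _).trans_lt (by norm_num)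
  -- Makes `-log (1 - η)` equal to `c b / 4`, hence at most `(c / 4) H` once `b ≤ H`.
  set η : ℝ := 1 - Real.exp (-(c / 4 * b)) with hη
  have hη1 : η < 1 := by linarith [Real.exp_pos (-((c : ℝ) / 4 * b))]
  have hη0 : 0 < η := by
    have : Real.exp (-((c : ℝ) / 4 * b)) < 1 := by
      rw [← Real.exp_zero, Real.exp_lt_exp, neg_lt_zero]
      positivity
    linarith
  have hηlog : ENNReal.ofReal (-Real.log (1 - η)) = (c / 4 : ℝ≥0) * b := by
    rw [hη, sub_sub_cancel, Real.log_exp, neg_neg, ENNReal.ofReal_mul (by positivity),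
      ENNReal.ofReal_coe_nnreal]
    congr 1
    rw [← ENNReal.ofReal_coe_nnreal]
    norm_num
  have hδc : ENNReal.ofReal δ ≤ (c / 4 : ℝ≥0) := by
    rw [← ENNReal.ofReal_coe_nnreal]
    exact ENNReal.ofReal_le_ofReal ((min_le_left _ _).trans (by norm_num))
  obtain ⟨k, hk⟩ : ∃ k : ℝ≥0, ENNReal.ofReal (-Real.log η) = k := ⟨_, rfl⟩
  -- The first bound gives `P E + P B ≤ c / 4`, the second `k P(E) ≤ c b / 4`; `k + 1` keeps the
  -- denominator positive.
  set τ : ℝ≥0 := min (c / 8) (c / 4 * b / (k + 1)) with hτ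
  have hτ0 : 0 < τ := lt_min (by positivity) (by positivity)
  have hkτ : (k : ℝ≥0∞) * τ ≤ (c / 4 : ℝ≥0) * b := by
    have : k * τ ≤ c / 4 * b :=
      calc k * τ ≤ (k + 1) * (c / 4 * b / (k + 1)) :=
            mul_le_mul' le_self_add (min_le_right _ _)
        _ = c / 4 * b := mul_div_cancel₀ _ (by positivity)
    exact_mod_cast this
  have hττ : (τ : ℝ≥0∞) + τ ≤ (c / 4 : ℝ≥0) := by
    have : τ + τ ≤ c / 4 :=
      calc τ + τ ≤ c / 8 + c / 8 := add_le_add (min_le_left _ _) (min_le_left _ _)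
        _ = c / 4 := by rw [← NNReal.coe_inj]; push_cast; ring
    exact_mod_cast this
  have hτ0' : (0 : ℝ≥0∞) < τ := by exact_mod_cast hτ0
  filter_upwards [hbH, herr.eventually_lt_const hτ0', (hAEP δ hδ0).eventually_lt_const hτ0']
    with n hbn herrn hAn
  rcases eq_or_ne (rvEntropy (P n) (X n)) ⊤ with htop | hfin
  · rw [htop, ENNReal.mul_top (by exact_mod_cast hc.ne')]
    exact le_top
  -- A decoder with error below `τ` suffices; the infimum need not be attained.
  simp only [listError, iInf_lt_iff] at herrn
  obtain ⟨f, hf, hfE⟩ := herrn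
  have hE := measurableSet_listError hf (hX n) (hY n)
  have hsum : (c : ℝ≥0∞) = (c / 4 : ℝ≥0) + ((c / 4 : ℝ≥0) + ((c / 4 : ℝ≥0) + (c / 4 : ℝ≥0))) := by
    have : c = c / 4 + (c / 4 + (c / 4 + c / 4)) := by
      rw [← NNReal.coe_inj]; push_cast; ring
    exact_mod_cast this
  rw [tsub_le_iff_left]
  refine (condEntropy_le (P n) (hX n) (hY n) (hL n) hf hη0 hη1).trans ?_
  rw [add_assoc]
  gcongr
  rw [hηlog, hk, hsum, add_mul, add_mul]
  refine add_le_add (by gcongr) (add_le_add ?_ ?_)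
  · calc _ ≤ (k : ℝ≥0∞) * τ := by gcongr
      _ ≤ (c / 4 : ℝ≥0) * b := hkτ
      _ ≤ _ := by gcongr
  · refine (setLIntegral_surprisal_le (P n) (hX n) hfin hδ0 hδ1 hE).trans ?_
    gcongr
    exact (add_le_add hfE.le hAn.le).trans hττ

theorem IsLittleOh.of_tsub {a b h : ℕ → ℝ≥0∞} (hab : IsLittleOh (fun n => a n - b n) h)
    (hb : IsLittleOh b h) : IsLittleOh a h := by
  intro c hc
  filter_upwards [hab (c / 2) (by positivity), hb (c / 2) (by positivity)] with n h1 h2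
  have hsum : (c : ℝ≥0∞) = (c / 2 : ℝ≥0) + (c / 2 : ℝ≥0) := by
    rw [← ENNReal.coe_add, add_halves]
  calc a n ≤ (a n - b n) + b n := le_tsub_add
    _ ≤ (c / 2 : ℝ≥0) * h n + (c / 2 : ℝ≥0) * h n := add_le_add h1 h2
    _ = c * h n := by rw [← add_mul, ← hsum]

end ListFano

/- Subtraction on `ℝ≥0∞` is truncated at `0`, so `H(Xₙ | Yₙ) - log Lₙ` below is the positive part
`|H(Xₙ | Yₙ) - log Lₙ|⁺`. -/
theorem theorem3 {Ω : ℕ → Type*} {𝒴 : ℕ → Type*}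
    [∀ n, MeasurableSpace (Ω n)] [∀ n, MeasurableSpace (𝒴 n)]
    (P : ∀ n, Measure (Ω n)) [∀ n, IsProbabilityMeasure (P n)]
    (X : ∀ n, Ω n → ℕ+) (hX : ∀ n, Measurable (X n))
    (Y : ∀ n, Ω n → 𝒴 n) (hY : ∀ n, Measurable (Y n))
    (L : ℕ → ℕ) (hL : ∀ n, 1 ≤ L n)
    (hAEP : ListFano.SatisfiesAEP P X)
    (hH : ListFano.IsOmegaOne (fun n => ListFano.rvEntropy (P n) (X n))) :
    (Tendsto (fun n => ListFano.listError (P n) (L n) (X n) (Y n)) atTop (𝓝 0) →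
      ListFano.IsLittleOh
        (fun n => ListFano.condEntropy (P n) (X n) (Y n) - ENNReal.ofReal (Real.log (L n)))
        (fun n => ListFano.rvEntropy (P n) (X n))) ∧
    (Tendsto (fun n => ListFano.listError (P n) (L n) (X n) (Y n)) atTop (𝓝 0) ∧
      ListFano.IsLittleOh (fun n => ENNReal.ofReal (Real.log (L n)))
        (fun n => ListFano.rvEntropy (P n) (X n)) →
      ListFano.IsLittleOh (fun n => ListFano.condEntropy (P n) (X n) (Y n))
        (fun n => ListFano.rvEntropy (P n) (X n))) := by
  have h := ListFano.isLittleOh_condEntropy_sub_log P X hX Y hY L hL hAEP hH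
  exact ⟨h, fun ⟨herr, hlog⟩ => (h herr).of_tsub hlog⟩
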